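/- Let $P$ be a finite poset with $k$ connected components $P_1,\dots,P_k$ (the classes of the equivalence relation generated by $\preceq$), let $G$ be a finite group, let $\mathbb{F}$ be a field, and let $\mathcal{A}=I(P,\mathbb{F})$ be the incidence algebra of $P$ over $\mathbb{F}$. A $G$-grading on $\mathcal{A}$ is a decomposition $\mathcal{A}=\bigoplus_{g\in G}\mathcal{A}_g$ into $\mathbb{F}$-subspaces with $\mathcal{A}_g\mathcal{A}_h\subseteq\mathcal{A}_{gh}$. It is elementary if there is $\theta\in G^P$ such that, for every $g\in G$, $$\mathcal{A}_g=\{f\in\mathcal{A} : f(x,y)=0 \text{ whenever } x\preceq y \text{ and } \theta(x)^{-1}\theta(y)\neq g\}.$$ Two gradings $(\mathcal{A}_g)$ and $(\mathcal{A}'_g)$ are isomorphic if some $\mathbb{F}$-algebra automorphism $\varphi$ of $\mathcal{A}$ satisfies $\varphi(\mathcal{A}_g)=\mathcal{A}'_g$ for all $g\in G$. For $\mathbf{h}=(h_1,\dots,h_k)\in G^k$, $\sigma\in\mathrm{Aut}(P)$ and $\theta\in G^P$, define $\mathbf{h}\theta\sigma\in G^P$ by $(\mathbf{h}\theta\sigma)(x)=h_i\,\theta(\sigma^{-1}(x))$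 for $x\in P_i$. The maps $\theta\mapsto\mathbf{h}\theta\sigma$ define an action on $G^P$ of the group with underlying set $G^k\times\mathrm{Aut}(P)$, namely the semidirect product $G^k\rtimes\mathrm{Aut}(P)$ in which $\mathrm{Aut}(P)$ permutes the factors of $G^k$ as it permutes the components of $P$. Then the number $n_G$ of elementary $G$-gradings on $\mathcal{A}$ up to isomorphism is the number of orbits of this action on $G^P$, and $$n_G=\frac{1}{|G|^k\,|\mathrm{Aut}(P)|}\sum_{(\mathbf{h},\sigma)\in G^k\times\mathrm{Aut}(P)}\bigl|X^{(\mathbf{h},\sigma)}\bigr|,\qquad X^{(\mathbf{h},\sigma)}=\{\theta\in G^P : \mathbf{h}\theta\sigma=\theta\}.$$ -/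

import Mathlib

namespace IncidenceGrading

/-! ### Gradings by a group and graded isomorphisms -/

/-- A `G`-grading on an associative `F`-algebra `R`: a family of subspaces `R_g` with
`R = ⨁ R_g` (internal direct sum) and `R_g R_h ⊆ R_{gh}`. -/
@[ext]
structure Grading (G F R : Type*) [Group G] [Field F] [Ring R] [Algebra F R] where
  /-- The homogeneous component of degree `g`. -/
  component : G → Submodule F R
  isInternal : open Classical in DirectSum.IsInternal component
  mul_mem : ∀ (g h : G) (a b : R), a ∈ component g → b ∈ component h → a * b ∈ component (g * h)

/-- Two gradings are isomorphic if some algebra automorphism maps, for every `g`, the component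
of degree `g` of the first onto the component of degree `g` of the second. -/
def Grading.Isomorphic {G F R : Type*} [Group G] [Field F] [Ring R] [Algebra F R]
    (A B : Grading G F R) : Prop :=
  ∃ φ : R ≃ₐ[F] R, ∀ g : G, (A.component g).map (φ : R →ₗ[F] R) = B.component g

theorem Grading.isomorphic_iff {G F R : Type*} [Group G] [Field F] [Ring R] [Algebra F R]
    (A B : Grading G F R) :
    A.Isomorphic B ↔
      ∃ φ : R ≃ₐ[F] R, ∀ (g : G) (r : R), φ r ∈ B.component g ↔ r ∈ A.component g := by
  refine exists_congr fun φ => forall_congr' fun g => ?_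
  constructor
  · intro h r
    rw [← h]
    constructor
    · rintro ⟨s, hs, hsr⟩
      have : s = r := φ.injective hsr
      exact this ▸ hs
    · intro hr
      exact ⟨r, hr, rfl⟩
  · intro h
    ext r
    constructor
    · rintro ⟨s, hs, rfl⟩
      exact (h s).2 hs
    · intro hr
      refine ⟨φ.symm r, (h _).1 ?_, ?_⟩
      · simpa using hr
      · simp

/-! ### Elementary gradings on incidence algebras -/

section Elementary

variable {G P : Type*} (F : Type*) [Group G] [Field F] [PartialOrder P]

/-- The subspace `A^θ(g)` of the incidence algebra: all `f` such that `f(x, y) = 0` whenever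
`x ≤ y` and `θ(x)⁻¹ θ(y) ≠ g`. -/
def elementaryComponent (θ : P → G) (g : G) : Submodule F (IncidenceAlgebra F P) where
  carrier := {f | ∀ x y : P, x ≤ y → (θ x)⁻¹ * θ y ≠ g → f x y = 0}
  zero_mem' := fun _ _ _ _ => rfl
  add_mem' := fun {f₁ f₂} h₁ h₂ x y hxy hg => by
    rw [IncidenceAlgebra.add_apply, h₁ x y hxy hg, h₂ x y hxy hg, add_zero]
  smul_mem' := fun c f h x y hxy hg => by
    rw [IncidenceAlgebra.constSMul_apply, h x y hxy hg, smul_zero]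

variable {F} [LocallyFiniteOrder P] [DecidableEq P]

/-- A `G`-grading on the incidence algebra is elementary if it is given by some `θ : P → G`. -/
def IsElementary (A : Grading G F (IncidenceAlgebra F P)) : Prop :=
  ∃ θ : P → G, ∀ g : G, A.component g = elementaryComponent F θ g

variable (G P F)

/-- The elementary `G`-gradings on the incidence algebra of `P` over `F`. -/
abbrev ElementaryGrading : Type _ :=
  {A : Grading G F (IncidenceAlgebra F P) // IsElementary A}

/-- Graded isomorphism as an equivalence relation on the elementary gradings. -/
def elementarySetoid : Setoid (ElementaryGrading G P F) where
  r A B := A.1.Isomorphic B.1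
  iseqv :=
    { refl := fun A => (Grading.isomorphic_iff _ _).2 ⟨AlgEquiv.refl, fun _ _ => Iff.rfl⟩
      symm := fun {A B} h => by
        obtain ⟨φ, hφ⟩ := (Grading.isomorphic_iff _ _).1 h
        exact (Grading.isomorphic_iff _ _).2 ⟨φ.symm, fun g r => by
          rw [← hφ g (φ.symm r), AlgEquiv.apply_symm_apply]⟩
      trans := fun {A B C} h₁ h₂ => by
        obtain ⟨φ, hφ⟩ := (Grading.isomorphic_iff _ _).1 h₁
        obtain ⟨ψ, hψ⟩ := (Grading.isomorphic_iff _ _).1 h₂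
        exact (Grading.isomorphic_iff _ _).2 ⟨φ.trans ψ, fun g r => by
          rw [AlgEquiv.trans_apply, hψ, hφ]⟩ }

/-- The number `n_G` of elementary `G`-gradings on the incidence algebra, counted up to graded
isomorphism. -/
noncomputable def numElementaryGradings : ℕ := Nat.card (Quotient (elementarySetoid G P F))

end Elementary

/-! ### Connected components and the group action on `G^P` -/

section Action

/-- The set of connected components of a poset: classes of the equivalence relation generated by
`≤`, i.e. `x`, `y` are identified when they are joined by a finite sequence of elements in which
consecutive ones are comparable. -/
abbrev Component (P : Type*) [PartialOrder P] : Type _ :=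
  Quotient (Relation.EqvGen.setoid ((· ≤ ·) : P → P → Prop))

variable {P : Type*} [PartialOrder P]

/-- The connected component of `x`. -/
def toComponent (x : P) : Component P := Quotient.mk _ x

/-- The map on connected components induced by an order automorphism. -/
def Component.map (σ : P ≃o P) : Component P → Component P :=
  Quotient.map σ fun x y h => by
    change Relation.EqvGen _ x y at h
    change Relation.EqvGen _ (σ x) (σ y)
    induction h with
    | rel x y h => exact .rel _ _ (σ.monotone h)
    | refl x => exact .refl _
    | symm x y _ ih => exact .symm _ _ ih
    | trans x y z _ _ ih₁ ih₂ => exact .trans _ _ _ ih₁ ih₂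

@[simp]
theorem Component.map_toComponent (σ : P ≃o P) (x : P) :
    Component.map σ (toComponent x) = toComponent (σ x) := rfl

theorem Component.map_one (c : Component P) : Component.map (1 : P ≃o P) c = c := by
  induction c using Quotient.inductionOn with
  | h x => rfl

theorem Component.map_mul (σ τ : P ≃o P) (c : Component P) :
    Component.map (σ * τ) c = Component.map σ (Component.map τ c) := by
  induction c using Quotient.inductionOn with
  | h x => rfl

variable {G : Type*} [Group G]

/-- The function `hθσ`, given by `(hθσ)(x) = h_c θ(σ⁻¹(x))` where `c` is the connected component
of `x`. -/
def translate (h : Component P → G) (σ : P ≃o P) (θ : P → G) : P → G :=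
  fun x => h (toComponent x) * θ (σ⁻¹ x)

variable (P G)

/-- `Aut(P)` acts on `G^k`, i.e. on the functions from the set of connected components to `G`, by
permuting the components. -/
def permuteComponents : (P ≃o P) →* MulAut (Component P → G) where
  toFun σ :=
    { toFun := fun h c => h (Component.map σ⁻¹ c)
      invFun := fun h c => h (Component.map σ c)
      left_inv := fun h => by
        funext c
        simp only [← Component.map_mul, inv_mul_cancel, Component.map_one]
      right_inv := fun h => by
        funext c
        simp only [← Component.map_mul, mul_inv_cancel, Component.map_one]
      map_mul' := fun _ _ => rfl }
  map_one' := by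
    ext h c
    change h (Component.map 1⁻¹ c) = h c
    rw [inv_one, Component.map_one]
  map_mul' σ τ := by
    ext h c
    change h (Component.map (σ * τ)⁻¹ c) = h (Component.map τ⁻¹ (Component.map σ⁻¹ c))
    rw [mul_inv_rev, Component.map_mul]

/-- The group of all pairs `(h, σ)` in `G^k × Aut(P)`, with the multiplication that corresponds to
composition of the maps `θ ↦ hθσ`. -/
abbrev TranslationGroup : Type _ :=
  SemidirectProduct (Component P → G) (P ≃o P) (permuteComponents P G)

/-- The action of the pairs `(h, σ)` on `G^P` by `θ ↦ hθσ`. -/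
instance translationAction : MulAction (TranslationGroup P G) (P → G) where
  smul a θ := translate a.left a.right θ
  one_smul θ := by
    funext x
    change (1 : G) * θ ((1 : P ≃o P)⁻¹ x) = θ x
    rw [one_mul, inv_one]
    rfl
  mul_smul a b θ := by
    funext x
    change (a.left (toComponent x) * b.left (Component.map a.right⁻¹ (toComponent x))) *
        θ ((a.right * b.right)⁻¹ x) =
      a.left (toComponent x) * (b.left (toComponent (a.right⁻¹ x)) * θ (b.right⁻¹ (a.right⁻¹ x)))
    rw [mul_inv_rev, mul_assoc]
    rfl

end Action

end IncidenceGrading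

namespace IncidenceGrading

/-! ### Matrix units and automorphisms of the incidence algebra. -/

section Incidence

variable {F P : Type*} [Field F] [PartialOrder P]

section

variable [LocallyFiniteOrder P]

/-! Every `θ` defines an elementary grading, so it suffices to show that isomorphism pulls back to
the orbit relation on `P → G` (`isomorphic_elementaryGrading_iff`); Burnside's lemma then gives the
formula.

Let `φ` be a graded automorphism and `e_xy` the matrix units. No classification of automorphisms is
needed, only a `σ` in `Aut(P)` with `φ(e_xy)` nonzero at `(σ x, σ y)`
(`exists_orderIso_of_algEquiv`). Since `φ(e_xy)` is homogeneous of degree `θ(x)⁻¹θ(y)`, that entry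
forces `θ'(σ x)⁻¹θ'(σ y) = θ(x)⁻¹θ(y)`. Hence `θ'(σ x)θ(x)⁻¹` is constant on components, which
supplies the tuple `h` (`exists_translate_eq`). Conversely, relabelling by `σ` realises the action
of `(h, σ)`, because `h` cancels in all degrees. -/

theorem mul_apply_diagonal (f g : IncidenceAlgebra F P) (x : P) :
    (f * g) x x = f x x * g x x := by
  simp [IncidenceAlgebra.mul_apply]

/-- A nonzero element is nonzero at some pair `(p, q)` for which every left (right) identity of the
element has value `1` at `(p, p)` (at `(q, q)`). -/
theorem exists_apply_ne_zero_of_ne_zero [Finite P] {f : IncidenceAlgebra F P} (hf : f ≠ 0) :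
    ∃ p q, f p q ≠ 0 ∧ (∀ a, a * f = f → a p p = 1) ∧ (∀ b, f * b = f → b q q = 1) := by
  -- With the first factor dualised, a minimal element is an inclusion-minimal interval `[p, q]`
  -- with `f p q ≠ 0`. In `(a * f) p q` and `(f * b) p q` only the terms with `a p p` and `b q q`
  -- then survive.
  have hne : {r : Pᵒᵈ × P | f (OrderDual.ofDual r.1) r.2 ≠ 0}.Nonempty := by
    by_contra h
    rw [Set.not_nonempty_iff_eq_empty] at h
    refine hf (IncidenceAlgebra.ext fun p q _ => ?_)
    by_contra hpq
    have : (OrderDual.toDual p, q) ∈ {r : Pᵒᵈ × P | f (OrderDual.ofDual r.1) r.2 ≠ 0} := hpq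
    rw [h] at this
    exact this
  obtain ⟨⟨p, q⟩, hpq, hmin⟩ := (Set.toFinite _).exists_minimal hne
  change f (OrderDual.ofDual p) q ≠ 0 at hpq
  have hle := IncidenceAlgebra.le_of_ne_zero hpq
  refine ⟨OrderDual.ofDual p, q, hpq, fun a ha => ?_, fun b hb => ?_⟩
  · have h := congrArg (fun g : IncidenceAlgebra F P => g (OrderDual.ofDual p) q) ha
    simp only [IncidenceAlgebra.mul_apply] at h
    rw [Finset.sum_eq_single (OrderDual.ofDual p)] at h
    · exact mul_right_cancel₀ hpq (h.trans (one_mul _).symm)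
    · intro c hc hcp
      by_contra h0
      have := hmin (y := (OrderDual.toDual c, q)) (right_ne_zero_of_mul h0)
        ⟨(Finset.mem_Icc.1 hc).1, le_rfl⟩
      exact hcp (le_antisymm this.1 (Finset.mem_Icc.1 hc).1)
    · intro h0
      exact (h0 (Finset.mem_Icc.2 ⟨le_rfl, hle⟩)).elim
  · have h := congrArg (fun g : IncidenceAlgebra F P => g (OrderDual.ofDual p) q) hb
    simp only [IncidenceAlgebra.mul_apply] at h
    rw [Finset.sum_eq_single q] at h
    · exact mul_left_cancel₀ hpq (h.trans (mul_one _).symm)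
    · intro c hc hcq
      by_contra h0
      have := hmin (y := (p, c)) (left_ne_zero_of_mul h0) ⟨le_rfl, (Finset.mem_Icc.1 hc).2⟩
      exact hcq (le_antisymm (Finset.mem_Icc.1 hc).2 this.2)
    · intro h0
      exact (h0 (Finset.mem_Icc.2 ⟨hle, le_rfl⟩)).elim

end

variable [DecidableEq P]

/-- The matrix unit of the incidence algebra supported at the pair `x ≤ y`. -/
def unitAt (F : Type*) [Field F] {x y : P} (h : x ≤ y) : IncidenceAlgebra F P where
  toFun a b := if a = x ∧ b = y then 1 else 0
  eq_zero_of_not_le' _ _ hab := if_neg fun ⟨ha, hb⟩ => hab (ha ▸ hb ▸ h)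

theorem unitAt_apply {x y : P} (h : x ≤ y) (a b : P) :
    unitAt F h a b = if a = x ∧ b = y then 1 else 0 := rfl

theorem unitAt_ne_zero {x y : P} (h : x ≤ y) : unitAt F h ≠ 0 := fun h0 => by
  have := congrArg (fun f : IncidenceAlgebra F P => f x y) h0
  simp [unitAt_apply, IncidenceAlgebra.zero_apply] at this

variable [LocallyFiniteOrder P]

theorem unitAt_mul_unitAt {x y z : P} (hxy : x ≤ y) (hyz : y ≤ z) :
    unitAt F hxy * unitAt F hyz = unitAt F (hxy.trans hyz) := by
  ext a b hab
  rw [IncidenceAlgebra.mul_apply]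
  simp only [unitAt_apply]
  by_cases h : a = x ∧ b = z
  · obtain ⟨rfl, rfl⟩ := h
    rw [Finset.sum_eq_single y]
    · simp
    · intro c _ hc
      simp [hc]
    · intro hy
      exact (hy (Finset.mem_Icc.2 ⟨hxy, hyz⟩)).elim
  · rw [if_neg h]
    refine Finset.sum_eq_zero fun c _ => ?_
    by_cases ha : a = x
    · have hb : b ≠ z := fun hb => h ⟨ha, hb⟩
      simp [hb]
    · simp [ha]

theorem unitAt_mul_unitAt_of_ne {x y z w : P} (hxy : x ≤ y) (hzw : z ≤ w) (hyz : y ≠ z) :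
    unitAt F hxy * unitAt F hzw = 0 := by
  ext a b hab
  rw [IncidenceAlgebra.mul_apply, IncidenceAlgebra.zero_apply]
  refine Finset.sum_eq_zero fun c _ => ?_
  simp only [unitAt_apply]
  by_cases hc : c = y
  · have : c ≠ z := fun h => hyz (hc.symm.trans h)
    simp [this]
  · simp [hc]

theorem finite_orderIso (Q : Type*) [PartialOrder Q] [Finite Q] : Finite (Q ≃o Q) :=
  Finite.of_injective (fun σ : Q ≃o Q => (σ : Q → Q)) DFunLike.coe_injective

/-- A monotone permutation of a finite poset is an order automorphism. -/
theorem exists_orderIso_of_monotone {Q : Type*} [PartialOrder Q] [Finite Q] (e : Equiv.Perm Q)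
    (he : Monotone e) : ∃ σ : Q ≃o Q, ∀ x, σ x = e x := by
  refine ⟨⟨e, fun {x y} => ⟨fun h => ?_, fun h => he h⟩⟩, fun _ => rfl⟩
  -- By finite order, the inverse of `e` is a power of `e`, hence monotone.
  obtain ⟨n, hn⟩ : ∃ n, e ^ (n + 1) = 1 :=
    ⟨orderOf e - 1, by rw [Nat.sub_add_cancel (orderOf_pos e), pow_orderOf_eq_one]⟩
  have hpow : Monotone (e ^ n : Equiv.Perm Q) := by
    rw [Equiv.Perm.coe_pow]
    exact he.iterate n
  have key : ∀ z, (e ^ n) (e z) = z := fun z => by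
    rw [← Equiv.Perm.mul_apply, ← pow_succ, hn, Equiv.Perm.one_apply]
  simpa only [key] using hpow h

/-- Every algebra automorphism of the incidence algebra induces an order automorphism. -/
theorem exists_orderIso_of_algEquiv [Finite P]
    (φ : IncidenceAlgebra F P ≃ₐ[F] IncidenceAlgebra F P) :
    ∃ σ : P ≃o P, ∀ (x y : P) (h : x ≤ y), φ (unitAt F h) (σ x) (σ y) ≠ 0 := by
  have hne : ∀ {x y : P} (h : x ≤ y), φ (unitAt F h) ≠ 0 := fun h h0 =>
    unitAt_ne_zero h ((map_eq_zero_iff φ φ.injective).1 h0)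
  -- An idempotent is a left identity of itself.
  have hex : ∀ x : P, ∃ p, φ (unitAt F (le_refl x)) p p = 1 := fun x => by
    obtain ⟨p, q, -, hp, -⟩ := exists_apply_ne_zero_of_ne_zero (hne (le_refl x))
    exact ⟨p, hp _ (by rw [← map_mul, unitAt_mul_unitAt])⟩
  choose s hs using hex
  -- Orthogonal idempotents cannot both have the value 1 at the same diagonal place.
  have hdisj : ∀ x y p, φ (unitAt F (le_refl x)) p p = 1 → φ (unitAt F (le_refl y)) p p = 1 →
      x = y := fun x y p hx hy => by
    by_contra hxy
    have h := mul_apply_diagonal (φ (unitAt F (le_refl x))) (φ (unitAt F (le_refl y))) p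
    rw [← map_mul, unitAt_mul_unitAt_of_ne _ _ hxy, map_zero, hx, hy, mul_one,
      IncidenceAlgebra.zero_apply] at h
    exact zero_ne_one h
  have hinj : Function.Injective s := fun x y h => hdisj x y (s x) (hs x) (h ▸ hs y)
  have hbij : Function.Bijective s := Finite.injective_iff_bijective.1 hinj
  have huniq : ∀ x p, φ (unitAt F (le_refl x)) p p = 1 → p = s x := fun x p hp => by
    obtain ⟨y, rfl⟩ := hbij.2 p
    rw [hdisj x y _ hp (hs y)]
  -- The images of `e_xx` and `e_yy` are left and right identities of that of `e_xy`, which pins the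
  -- nonzero entry to `(s x, s y)`.
  have hval : ∀ (x y : P) (h : x ≤ y), φ (unitAt F h) (s x) (s y) ≠ 0 := fun x y h => by
    obtain ⟨p, q, hpq, hp, hq⟩ := exists_apply_ne_zero_of_ne_zero (hne h)
    rw [← huniq x p (hp _ (by rw [← map_mul, unitAt_mul_unitAt])),
      ← huniq y q (hq _ (by rw [← map_mul, unitAt_mul_unitAt]))]
    exact hpq
  obtain ⟨σ, hσ⟩ := exists_orderIso_of_monotone (Equiv.ofBijective s hbij)
    fun x y h => IncidenceAlgebra.le_of_ne_zero (hval x y h)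
  refine ⟨σ, fun x y h => ?_⟩
  rw [hσ, hσ]
  exact hval x y h

/-- The algebra automorphism of the incidence algebra induced by an order automorphism. -/
def reindex (F : Type*) [Field F] (σ : P ≃o P) :
    IncidenceAlgebra F P ≃ₐ[F] IncidenceAlgebra F P :=
  AlgEquiv.ofLinearEquiv
    { toFun := fun f => ⟨fun a b => f (σ.symm a) (σ.symm b), fun _ _ h =>
        IncidenceAlgebra.apply_eq_zero_of_not_le (fun h' => h (σ.symm.le_iff_le.1 h')) f⟩
      invFun := fun f => ⟨fun a b => f (σ a) (σ b), fun _ _ h =>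
        IncidenceAlgebra.apply_eq_zero_of_not_le (fun h' => h (σ.le_iff_le.1 h')) f⟩
      left_inv := fun f => IncidenceAlgebra.ext fun a b _ => by
        change f (σ.symm (σ a)) (σ.symm (σ b)) = f a b
        rw [σ.symm_apply_apply, σ.symm_apply_apply]
      right_inv := fun f => IncidenceAlgebra.ext fun a b _ => by
        change f (σ (σ.symm a)) (σ (σ.symm b)) = f a b
        rw [σ.apply_symm_apply, σ.apply_symm_apply]
      map_add' := fun _ _ => rfl
      map_smul' := fun _ _ => rfl }
    (IncidenceAlgebra.ext fun a b _ => by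
      change (if σ.symm a = σ.symm b then (1 : F) else 0) = if a = b then 1 else 0
      simp only [σ.symm.injective.eq_iff])
    (fun f g => IncidenceAlgebra.ext fun a b _ => by
      change ∑ z ∈ Finset.Icc (σ.symm a) (σ.symm b), f (σ.symm a) z * g z (σ.symm b) =
        ∑ z ∈ Finset.Icc a b, f (σ.symm a) (σ.symm z) * g (σ.symm z) (σ.symm b)
      symm
      refine Finset.sum_equiv σ.symm.toEquiv (fun z => ?_) fun z _ => rfl
      simp)

theorem reindex_apply (σ : P ≃o P) (f : IncidenceAlgebra F P) (a b : P) :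
    reindex F σ f a b = f (σ⁻¹ a) (σ⁻¹ b) := rfl

end Incidence

/-! ### Elementary gradings as gradings. -/

section Elementary

variable {G P F : Type*} [Group G] [Field F] [PartialOrder P]

theorem mem_elementaryComponent {θ : P → G} {g : G} {f : IncidenceAlgebra F P} :
    f ∈ elementaryComponent F θ g ↔ ∀ x y, x ≤ y → (θ x)⁻¹ * θ y ≠ g → f x y = 0 := Iff.rfl

theorem unitAt_mem_elementaryComponent [DecidableEq P] (θ : P → G) {x y : P} (h : x ≤ y) :
    unitAt F h ∈ elementaryComponent F θ ((θ x)⁻¹ * θ y) := fun a b _ hg =>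
  if_neg fun ⟨ha, hb⟩ => hg (by rw [ha, hb])

theorem iSupIndep_elementaryComponent (θ : P → G) :
    iSupIndep (elementaryComponent F θ) := by
  intro g
  rw [Submodule.disjoint_def]
  intro f hf hf'
  -- Vanishing at all pairs of degree `g` is a linear condition satisfied by every other component.
  let S : Submodule F (IncidenceAlgebra F P) :=
    { carrier := {f | ∀ x y : P, (θ x)⁻¹ * θ y = g → f x y = 0}
      zero_mem' := fun _ _ _ => rfl
      add_mem' := fun {f₁ f₂} h₁ h₂ x y hg => by
        rw [IncidenceAlgebra.add_apply, h₁ x y hg, h₂ x y hg, add_zero]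
      smul_mem' := fun c f h x y hg => by
        rw [IncidenceAlgebra.constSMul_apply, h x y hg, smul_zero] }
  have hS : (⨆ (j : G) (_ : j ≠ g), elementaryComponent F θ j) ≤ S := by
    refine iSup₂_le fun j hj e he x y hxy => ?_
    by_cases hle : x ≤ y
    · exact he x y hle (fun h => hj (h.symm.trans hxy))
    · exact IncidenceAlgebra.apply_eq_zero_of_not_le hle e
  refine IncidenceAlgebra.ext fun x y hxy => ?_
  by_cases h : (θ x)⁻¹ * θ y = g
  · exact hS hf' x y h
  · exact hf x y hxy h

theorem iSup_elementaryComponent [Finite G] (θ : P → G) :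
    ⨆ g, elementaryComponent F θ g = ⊤ := by
  classical
  have := Fintype.ofFinite G
  refine eq_top_iff.2 fun f _ => ?_
  let part : G → IncidenceAlgebra F P := fun g =>
    ⟨fun x y => if (θ x)⁻¹ * θ y = g then f x y else 0, fun x y h => by
      rw [IncidenceAlgebra.apply_eq_zero_of_not_le h, ite_self]⟩
  -- Evaluation as an additive map, so that `map_sum` applies.
  let ev : P → P → IncidenceAlgebra F P →+ F := fun x y =>
    { toFun := fun e => e x y
      map_zero' := rfl
      map_add' := fun _ _ => rfl }
  have hf : f = ∑ g, part g := by
    refine IncidenceAlgebra.ext fun x y _ => ?_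
    change f x y = ev x y (∑ g, part g)
    rw [map_sum]
    change f x y = ∑ g, if (θ x)⁻¹ * θ y = g then f x y else 0
    simp
  rw [hf]
  refine Submodule.sum_mem _ fun g _ => Submodule.mem_iSup_of_mem g fun x y _ hg => ?_
  exact if_neg hg

variable [LocallyFiniteOrder P] [DecidableEq P]

/-- The elementary grading defined by `θ`. -/
def elementaryGrading [Finite G] (F : Type*) [Field F] (θ : P → G) : ElementaryGrading G P F :=
  ⟨{ component := elementaryComponent F θ
     isInternal := by
      classical
      exact DirectSum.isInternal_submodule_of_iSupIndep_of_iSup_eq_top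
        (iSupIndep_elementaryComponent θ) (iSup_elementaryComponent θ)
     mul_mem := fun g h a b ha hb x y _ hg => by
      rw [IncidenceAlgebra.mul_apply]
      refine Finset.sum_eq_zero fun z hz => ?_
      obtain ⟨hxz, hzy⟩ := Finset.mem_Icc.1 hz
      by_cases h₁ : (θ x)⁻¹ * θ z = g
      · rw [hb z y hzy, mul_zero]
        rintro rfl
        exact hg (by rw [← h₁]; group)
      · rw [ha x z hxz h₁, zero_mul] }, θ, fun _ => rfl⟩

theorem elementaryGrading_component [Finite G] (θ : P → G) :
    (elementaryGrading F θ).1.component = elementaryComponent F θ := rfl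

theorem elementaryGrading_surjective [Finite G] :
    Function.Surjective (elementaryGrading F : (P → G) → ElementaryGrading G P F) := by
  rintro ⟨A, θ, hA⟩
  exact ⟨θ, Subtype.ext (Grading.ext (funext fun g => (hA g).symm))⟩

end Elementary

/-! ### Graded isomorphism as the orbit relation, and orbit counting. -/

section Action

variable {P G : Type*} [PartialOrder P] [Group G]

theorem toComponent_eq_of_le {x y : P} (h : x ≤ y) : toComponent x = toComponent y :=
  Quotient.sound (Relation.EqvGen.rel _ _ h)

/-- Comparable elements share a component, so the factor from `h` cancels. -/
theorem translate_inv_mul_translate (h : Component P → G) (σ : P ≃o P) (θ : P → G) {x y : P}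
    (hxy : x ≤ y) :
    (translate h σ θ x)⁻¹ * translate h σ θ y = (θ (σ⁻¹ x))⁻¹ * θ (σ⁻¹ y) := by
  simp only [translate, toComponent_eq_of_le hxy]
  group

/-- If `θ` and `θ'` induce the same degrees up to `σ`, then `θ' = hθσ` for some `h`. -/
theorem exists_translate_eq (σ : P ≃o P) (θ θ' : P → G)
    (h : ∀ x y, x ≤ y → (θ' (σ x))⁻¹ * θ' (σ y) = (θ x)⁻¹ * θ y) :
    ∃ c : Component P → G, translate c σ θ = θ' := by
  have hle : ∀ x y : P, x ≤ y → θ' x * (θ (σ⁻¹ x))⁻¹ = θ' y * (θ (σ⁻¹ y))⁻¹ := fun x y hxy => by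
    have h₁ := h (σ⁻¹ x) (σ⁻¹ y) (σ⁻¹.monotone hxy)
    rw [show σ (σ⁻¹ x) = x from σ.apply_symm_apply x,
      show σ (σ⁻¹ y) = y from σ.apply_symm_apply y] at h₁
    rw [eq_mul_inv_iff_mul_eq, mul_assoc, ← h₁, mul_inv_cancel_left]
  refine ⟨Quotient.lift (fun x => θ' x * (θ (σ⁻¹ x))⁻¹) fun x y hxy => ?_, ?_⟩
  · change Relation.EqvGen _ x y at hxy
    induction hxy with
    | rel x y h => exact hle x y h
    | refl x => rfl
    | symm x y _ ih => exact ih.symm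
    | trans x y z _ _ ih₁ ih₂ => exact ih₁.trans ih₂
  · funext x
    exact inv_mul_cancel_right _ _

theorem smul_eq_translate (a : TranslationGroup P G) (θ : P → G) :
    a • θ = translate a.left a.right θ := rfl

variable {F : Type*} [Field F] [LocallyFiniteOrder P] [DecidableEq P] [Finite G]

/-- Two elementary gradings are isomorphic exactly if the maps that define them lie in the same
orbit. -/
theorem isomorphic_elementaryGrading_iff [Finite P] (θ θ' : P → G) :
    (elementaryGrading F θ).1.Isomorphic (elementaryGrading F θ').1 ↔
      ∃ a : TranslationGroup P G, a • θ = θ' := by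
  rw [Grading.isomorphic_iff]
  simp only [elementaryGrading_component]
  constructor
  · rintro ⟨φ, hφ⟩
    obtain ⟨σ, hσ⟩ := exists_orderIso_of_algEquiv φ
    obtain ⟨c, hc⟩ := exists_translate_eq σ θ θ' fun x y hxy => by
      -- A wrong degree would make the entry of `φ(e_xy)` at `(σ x, σ y)` vanish.
      by_contra hne
      exact hσ x y hxy ((hφ _ _).2 (unitAt_mem_elementaryComponent θ hxy) (σ x) (σ y)
        (σ.monotone hxy) hne)
    exact ⟨⟨c, σ⟩, hc⟩
  · rintro ⟨a, rfl⟩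
    refine ⟨reindex F a.right, fun g f => ?_⟩
    simp only [mem_elementaryComponent, smul_eq_translate]
    constructor
    · intro h x y hxy hg
      have h₁ := h (a.right x) (a.right y) (a.right.monotone hxy)
      rw [translate_inv_mul_translate _ _ _ (a.right.monotone hxy), reindex_apply,
        show a.right⁻¹ (a.right x) = x from a.right.symm_apply_apply x,
        show a.right⁻¹ (a.right y) = y from a.right.symm_apply_apply y] at h₁
      exact h₁ hg
    · intro h x y hxy hg
      rw [translate_inv_mul_translate _ _ _ hxy] at hg
      exact h _ _ (a.right⁻¹.monotone hxy) hg

theorem numElementaryGradings_eq_card_orbits (F : Type*) [Field F] [Finite P] :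
    numElementaryGradings G P F =
      Nat.card (MulAction.orbitRel.Quotient (TranslationGroup P G) (P → G)) := by
  have hrel : ∀ θ θ' : P → G, MulAction.orbitRel (TranslationGroup P G) (P → G) θ θ' ↔
      elementarySetoid G P F (elementaryGrading F θ) (elementaryGrading F θ') := fun θ θ' => by
    -- `orbitRel` puts `θ` in the orbit of `θ'`, hence the swap.
    rw [Setoid.comm' (elementarySetoid G P F), MulAction.orbitRel_apply]
    exact (isomorphic_elementaryGrading_iff θ' θ).symm
  refine (Nat.card_congr (Equiv.ofBijective
    (Quotient.map (elementaryGrading F) fun θ θ' h => (hrel θ θ').1 h) ⟨?_, ?_⟩)).symm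
  · intro p q
    induction p, q using Quotient.inductionOn₂ with
    | h θ θ' => exact fun h => Quotient.sound ((hrel θ θ').2 (Quotient.exact h))
  · intro p
    induction p using Quotient.inductionOn with
    | h A =>
      obtain ⟨θ, rfl⟩ := elementaryGrading_surjective A
      exact ⟨Quotient.mk _ θ, rfl⟩

/-- Burnside's lemma for the semidirect product, with the sum transported to pairs `(h, σ)`. -/
theorem finsum_card_fixed_eq (P G : Type*) [PartialOrder P] [Group G] [Finite P] [Finite G] :
    ∑ᶠ p : (Component P → G) × (P ≃o P),
        (Nat.card {θ : P → G // translate p.1 p.2 θ = θ} : ℚ) =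
      Nat.card (MulAction.orbitRel.Quotient (TranslationGroup P G) (P → G)) *
        ((Nat.card G : ℚ) ^ Nat.card (Component P) * Nat.card (P ≃o P)) := by
  classical
  have := finite_orderIso P
  have : Finite (TranslationGroup P G) := Finite.of_equiv _ SemidirectProduct.equivProd.symm
  have := Fintype.ofFinite (TranslationGroup P G)
  have := Fintype.ofFinite (MulAction.orbitRel.Quotient (TranslationGroup P G) (P → G))
  have := fun a : TranslationGroup P G => Fintype.ofFinite (MulAction.fixedBy (P → G) a)
  have h := MulAction.sum_card_fixedBy_eq_card_orbits_mul_card_group (TranslationGroup P G) (P → G)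
  simp only [← Nat.card_eq_fintype_card] at h
  rw [SemidirectProduct.card, Nat.card_fun] at h
  rw [← finsum_comp_equiv (SemidirectProduct.equivProd (φ := permuteComponents P G)),
    finsum_eq_sum_of_fintype]
  exact_mod_cast h

end Action

end IncidenceGrading

theorem mainTheorem6 {P : Type*} [PartialOrder P] [LocallyFiniteOrder P] [DecidableEq P] [Finite P]
    {G : Type*} [Group G] [Finite G] (F : Type*) [Field F]
    (k : ℕ) (hk : Nat.card (IncidenceGrading.Component P) = k) :
    IncidenceGrading.numElementaryGradings G P F =
        Nat.card (MulAction.orbitRel.Quotient (IncidenceGrading.TranslationGroup P G) (P → G)) ∧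
      (IncidenceGrading.numElementaryGradings G P F : ℚ) =
        1 / ((Nat.card G : ℚ) ^ k * (Nat.card (P ≃o P) : ℚ)) *
          ∑ᶠ p : (IncidenceGrading.Component P → G) × (P ≃o P),
            (Nat.card {θ : P → G // IncidenceGrading.translate p.1 p.2 θ = θ} : ℚ) := by
  have horb := IncidenceGrading.numElementaryGradings_eq_card_orbits (P := P) (G := G) F
  refine ⟨horb, ?_⟩
  rw [IncidenceGrading.finsum_card_fixed_eq, ← horb, hk]
  have := IncidenceGrading.finite_orderIso P
  have hG : (Nat.card G : ℚ) ≠ 0 := Nat.cast_ne_zero.2 Nat.card_pos.ne'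
  have hP : (Nat.card (P ≃o P) : ℚ) ≠ 0 := Nat.cast_ne_zero.2 Nat.card_pos.ne'
  field_simp
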